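/- Let $X$ be a connected, locally path connected space, let $x_0\in X$, and let $H\le \pi_1(X,x_0)$. For paths $\alpha,\beta$ starting at $x_0$ with the same endpoint, write $[\alpha]_H=[\beta]_H$ if $[\alpha*\beta^{-1}]\in H$. Suppose that $X$ is a strong $H$-small loop transfer space at $x_0$, that is: for every $x\in X$ and every open neighborhood $U$ of $x_0$ there is an open neighborhood $V$ of $x$ such that for every loop $\beta$ in $V$ based at $x$ and every path $\alpha$ in $X$ from $x_0$ to $x$ there is a loop $\lambda$ in $U$ based at $x_0$ with $[\alpha*\beta*\alpha^{-1}]_H=[\lambda]_H$. Let $\pi_1^{qtop}(X,x_0)$ be $\pi_1(X,x_0)$ with the quotient topology induced from the loop space $\Omega(X,x_0)$ with the compact-open topology, and let $K$ be a subgroup of $\pi_1(X,x_0)$ that contains $H$ and is open in $\pi_1^{qtop}(X,x_0)$. Then: 1. there is an open cover $\mathcal U$ of $X$ such that $\pi(\mathcal U,x_0)\le K$, where the Spanier group $\pi(\mathcal U,x_0)$ is the subgroup of $\pi_1(X,x_0)$ generated by the classes $[\alpha*\beta*\alpha^{-1}]$ with $\alpha$ a path starting at $x_0$ and $\beta$ a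 loop based at $\alpha(1)$ lying in some member of $\mathcal U$; 2. there are a path connected space $\widetilde X$, a covering map $p:\widetilde X\to X$ and a point $\tilde x_0\in\widetilde X$ with $p(\tilde x_0)=x_0$ such that $p_*\pi_1(\widetilde X,\tilde x_0)=K$. -/

import Mathlib

universe u

open scoped Topology

namespace StrongSLT

noncomputable section

variable {X : Type*} [TopologicalSpace X]

/-- The class in the fundamental group of a loop based at `x`.  Mathlib multiplies in the order
`[p] * [q] = [q.trans p]`, opposite to the usual one; subgroups are the same for both orders. -/
def loopClass {x : X} (γ : Path x x) : FundamentalGroup X x :=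
  FundamentalGroup.fromPath (Path.Homotopic.Quotient.mk γ)

/-- The quasitopological fundamental group: the quotient topology that the fundamental group
inherits from the loop space `Path x x` with the compact-open topology. -/
abbrev qtop (X : Type*) [TopologicalSpace X] (x : X) : TopologicalSpace (FundamentalGroup X x) :=
  TopologicalSpace.coinduced (loopClass (x := x)) inferInstance

/-- The equality of classes `[α]_H = [β]_H`, for paths `α` and `β` that start at `x₀` and have the
same endpoint: the loop `α * β⁻¹` represents an element of `H`. -/
def EqMod {x₀ y : X} (H : Subgroup (FundamentalGroup X x₀)) (α β : Path x₀ y) : Prop :=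
  loopClass (α.trans β.symm) ∈ H

/-- `X` is a strong `H`-small loop transfer space at `x₀`. -/
def IsStrongSLTAt (x₀ : X) (H : Subgroup (FundamentalGroup X x₀)) : Prop :=
  ∀ x : X, ∀ U : Set X, IsOpen U → x₀ ∈ U →
    ∃ V : Set X, IsOpen V ∧ x ∈ V ∧
      ∀ β : Path x x, Set.range β ⊆ V → ∀ α : Path x₀ x,
        ∃ γ : Path x₀ x₀, Set.range γ ⊆ U ∧ EqMod H ((α.trans β).trans α.symm) γ

/-- `𝒰` is an open cover of `X`. -/
def IsOpenCover (𝒰 : Set (Set X)) : Prop :=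
  (∀ U ∈ 𝒰, IsOpen U) ∧ ⋃₀ 𝒰 = Set.univ

/-- The Spanier group of `𝒰` at `x`: the subgroup generated by the classes of the loops
`α * β * α⁻¹`, where `α` is a path starting at `x` and `β` is a loop inside a member of `𝒰`. -/
def spanierGroup (𝒰 : Set (Set X)) (x : X) : Subgroup (FundamentalGroup X x) :=
  Subgroup.closure {g | ∃ (y : X) (α : Path x y) (β : Path y y),
    (∃ U ∈ 𝒰, Set.range β ⊆ U) ∧ g = loopClass ((α.trans β).trans α.symm)}

end

end StrongSLT

/-!
An open subgroup `K` of the quasitopological fundamental group contains the classes of all loops in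
some neighborhood `U` of `x₀`, because the constant loop has a neighborhood basis of this kind in
the compact-open topology. The small loop transfer property moves every loop near an arbitrary
point `x`, conjugated by an arbitrary path, to a loop in `U` modulo `H ≤ K`. Path connected
neighborhoods make the choice of basepoint of the small loop immaterial, so the resulting cover has
its Spanier group inside `K` (`exists_isOpenCover_spanierGroup_le`).

Conversely, every subgroup `K` that contains the Spanier group of an open cover comes from a
covering (`exists_isCoveringMap_of_spanierGroup_le`). The fiber over `y` is the discrete set
`CosetFiber K y` of path classes from `x₀` to `y` modulo `K`, on which path classes starting at `y`
act by extension. Loops inside a member of the cover act trivially (`CosetFiber.trans_loop`); hence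
extension along paths inside such a member depends only on the endpoints, and gives charts with
locally constant transition maps. A path `γ` from `x₀` lifts to the path of cosets of its initial
segments (`cosetLift`), which ends at the coset of `γ`. Thus the covering space is path connected,
and by uniqueness of lifts a loop lifts to a loop exactly when its class belongs to `K`.
-/

open scoped unitInterval
open Set Filter Bundle

noncomputable section

variable {X : Type u} [TopologicalSpace X]

/-! ### Cancellation of path classes -/

namespace Path.Homotopic.Quotient

variable {x y z : X}

@[simp]
theorem symm_trans_cancel_left (a : Path.Homotopic.Quotient x y)
    (b : Path.Homotopic.Quotient y z) : a.symm.trans (a.trans b) = b := by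
  rw [← trans_assoc, symm_trans, refl_trans]

@[simp]
theorem trans_symm_cancel_left (a : Path.Homotopic.Quotient x y)
    (b : Path.Homotopic.Quotient x z) : a.trans (a.symm.trans b) = b := by
  rw [← trans_assoc, trans_symm, refl_trans]

@[simp]
theorem symm_symm (a : Path.Homotopic.Quotient x y) : a.symm.symm = a := by
  induction a using Path.Homotopic.Quotient.ind with
  | mk p => rw [← mk_symm, ← mk_symm, Path.symm_symm]

@[simp]
theorem symm_of_trans (a : Path.Homotopic.Quotient x y) (b : Path.Homotopic.Quotient y z) :
    (a.trans b).symm = b.symm.trans a.symm := by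
  induction a using Path.Homotopic.Quotient.ind with
  | mk p =>
    induction b using Path.Homotopic.Quotient.ind with
    | mk q => rw [← mk_trans, ← mk_symm, Path.trans_symm]; rfl

end Path.Homotopic.Quotient

namespace StrongSLT

/-! ### The open cover -/

/-- Near the constant loop, the compact-open topology only constrains the range of a loop, so an open
subgroup contains the classes of all sufficiently small loops. -/
theorem exists_open_loopClass_mem {x₀ : X} {K : Subgroup (FundamentalGroup X x₀)}
    (hK : IsOpen[qtop X x₀] (K : Set (FundamentalGroup X x₀))) :
    ∃ U : Set X, IsOpen U ∧ x₀ ∈ U ∧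
      ∀ γ : Path x₀ x₀, range γ ⊆ U → loopClass γ ∈ K := by
  have hopen : IsOpen {γ : Path x₀ x₀ | loopClass γ ∈ K} := isOpen_coinduced.mp hK
  have hone : Path.refl x₀ ∈ {γ : Path x₀ x₀ | loopClass γ ∈ K} := K.one_mem
  have hmem := hopen.mem_nhds hone
  rw [nhds_induced, Filter.mem_comap] at hmem
  obtain ⟨S, hS, hSK⟩ := hmem
  obtain ⟨⟨C, U⟩, ⟨-, hxU, hU⟩, hCU⟩ :=
    (nhds_basis_opens x₀).nhds_continuousMapConst.mem_iff.mp hS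
  exact ⟨U, hU, hxU, fun γ hγ ↦ hSK (hCU fun t _ ↦ hγ (mem_range_self t))⟩

theorem exists_isOpenCover_spanierGroup_le [LocallyPathConnectedSpace X] {x₀ : X}
    {H K : Subgroup (FundamentalGroup X x₀)} (hX : IsStrongSLTAt x₀ H) (hHK : H ≤ K)
    (hK : IsOpen[qtop X x₀] (K : Set (FundamentalGroup X x₀))) :
    ∃ 𝒰 : Set (Set X), IsOpenCover 𝒰 ∧ spanierGroup 𝒰 x₀ ≤ K := by
  obtain ⟨U, hU, hxU, hUK⟩ := exists_open_loopClass_mem hK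
  choose V hV hxV hVH using fun x ↦ hX x U hU hxU
  refine ⟨range fun x ↦ pathComponentIn (V x) x, ⟨?_, ?_⟩, ?_⟩
  · rintro _ ⟨x, rfl⟩
    exact (hV x).pathComponentIn x
  · exact eq_univ_of_forall fun x ↦
      ⟨_, ⟨x, rfl⟩, mem_pathComponentIn_self (hxV x)⟩
  · refine (Subgroup.closure_le K).mpr ?_
    rintro _ ⟨y, α, β, ⟨_, ⟨x, rfl⟩, hβ⟩, rfl⟩
    have hy : JoinedIn (V x) x y := by
      have h := hβ (mem_range_self 0)
      rwa [β.source] at h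
    -- Transport `β` to the point `x` along a path `δ` inside `V x`.
    let δ := hy.somePath
    have hδ : range δ ⊆ V x := range_subset_iff.mpr hy.somePath_mem
    obtain ⟨γ, hγU, hγ⟩ := hVH x ((δ.trans β).trans δ.symm)
      (by
        rw [Path.trans_range, Path.trans_range, Path.symm_range]
        exact union_subset (union_subset hδ (hβ.trans pathComponentIn_subset)) hδ)
      (α.trans δ.symm)
    -- In Mathlib's order of multiplication, this product is the class `[α * β * α⁻¹ * γ⁻¹ * γ]`.
    have hmul := K.mul_mem (hUK γ hγU) (hHK hγ)
    convert hmul using 1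
    rw [FundamentalGroup.mul_def]
    simp only [loopClass, Path.Homotopic.Quotient.mk_trans, Path.Homotopic.Quotient.mk_symm]
    simp

/-! ### Path classes modulo a subgroup -/

/-- Two classes of paths from `x₀` to `y` are related when they differ by an element of `K`, acting
by precomposition.  This is `EqMod K` on classes of paths. -/
def cosetSetoid {x₀ : X} (K : Subgroup (FundamentalGroup X x₀)) (y : X) :
    Setoid (Path.Homotopic.Quotient x₀ y) where
  r a b := FundamentalGroup.fromPath (a.trans b.symm) ∈ K
  iseqv :=
    { refl := fun a ↦ by
        rw [Path.Homotopic.Quotient.trans_symm]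
        exact K.one_mem
      symm := fun {a b} h ↦ by
        have h' := K.inv_mem h
        convert h' using 1
        rw [FundamentalGroup.inv_def]
        simp
      trans := fun {a b c} h h' ↦ by
        have h'' := K.mul_mem h' h
        convert h'' using 1
        rw [FundamentalGroup.mul_def]
        simp }

/-- The classes of paths from `x₀` to `y` modulo `K`; the fiber over `y` of the covering space that
belongs to `K`. -/
def CosetFiber {x₀ : X} (K : Subgroup (FundamentalGroup X x₀)) (y : X) : Type u :=
  Quotient (cosetSetoid K y)

namespace CosetFiber

variable {x₀ : X} {K : Subgroup (FundamentalGroup X x₀)} {y z w : X}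

instance : TopologicalSpace (CosetFiber K y) := ⊥

instance : DiscreteTopology (CosetFiber K y) := ⟨rfl⟩

/-- The coset of a class of paths. -/
def mk (K : Subgroup (FundamentalGroup X x₀)) (a : Path.Homotopic.Quotient x₀ y) :
    CosetFiber K y :=
  Quotient.mk (cosetSetoid K y) a

theorem mk_eq_mk {a b : Path.Homotopic.Quotient x₀ y} :
    mk K a = mk K b ↔ FundamentalGroup.fromPath (a.trans b.symm) ∈ K :=
  Quotient.eq (r := cosetSetoid K y)

theorem mk_eq_mk_refl {a : Path.Homotopic.Quotient x₀ x₀} :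
    mk K a = mk K (.refl x₀) ↔ FundamentalGroup.fromPath a ∈ K := by
  rw [mk_eq_mk, show (Path.Homotopic.Quotient.refl x₀).symm = .refl x₀ from
    congrArg Path.Homotopic.Quotient.mk Path.refl_symm, Path.Homotopic.Quotient.trans_refl]

theorem mk_surjective : Function.Surjective (mk K (y := y)) :=
  Quotient.mk_surjective

/-- Extension of a coset of paths by a path class. -/
def trans (q : CosetFiber K y) (c : Path.Homotopic.Quotient y z) : CosetFiber K z :=
  Quotient.map (sa := cosetSetoid K y) (sb := cosetSetoid K z) (fun a ↦ a.trans c)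
    (fun a b (h : FundamentalGroup.fromPath (a.trans b.symm) ∈ K) ↦ by
      change FundamentalGroup.fromPath ((a.trans c).trans (b.trans c).symm) ∈ K
      convert h using 2
      simp) q

@[simp]
theorem mk_trans (a : Path.Homotopic.Quotient x₀ y) (c : Path.Homotopic.Quotient y z) :
    (mk K a).trans c = mk K (a.trans c) :=
  rfl

@[simp]
theorem trans_trans (q : CosetFiber K y) (c : Path.Homotopic.Quotient y z)
    (c' : Path.Homotopic.Quotient z w) : (q.trans c).trans c' = q.trans (c.trans c') := by
  obtain ⟨a, rfl⟩ := mk_surjective q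
  simp

@[simp]
theorem trans_refl (q : CosetFiber K y) : q.trans (.refl y) = q := by
  obtain ⟨a, rfl⟩ := mk_surjective q
  simp

/-- Loops inside a member of a cover whose Spanier group lies in `K` act trivially on cosets. -/
theorem trans_loop {𝒰 : Set (Set X)} (h𝒰 : spanierGroup 𝒰 x₀ ≤ K) {U : Set X} (hU : U ∈ 𝒰)
    (q : CosetFiber K y) (β : Path y y) (hβ : range β ⊆ U) :
    q.trans (.mk β) = q := by
  obtain ⟨a, rfl⟩ := mk_surjective q
  obtain ⟨α, rfl⟩ := Path.Homotopic.Quotient.mk_surjective a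
  exact mk_eq_mk.mpr (h𝒰 (Subgroup.subset_closure ⟨y, α, β, ⟨U, hU, hβ⟩, rfl⟩))

end CosetFiber

/-! ### The covering space of a subgroup -/

section Covering

variable [PathConnectedSpace X] {x₀ : X} {K : Subgroup (FundamentalGroup X x₀)} {U : X → Set X}

open scoped Classical in
/-- A class of paths from `x₀` to `y` that serves as the origin of the chart around `x`: when
possible it passes through `x` and then stays in `U x`; otherwise it is arbitrary. -/
def chartPath (x₀ : X) (U : X → Set X) (x y : X) : Path.Homotopic.Quotient x₀ y :=
  if h : JoinedIn (U x) x y then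
    .mk ((PathConnectedSpace.somePath x₀ x).trans h.somePath)
  else .mk (PathConnectedSpace.somePath x₀ y)

variable (K U) in
/-- Loops inside the sets `U x` act trivially on paths modulo `K`. -/
def ActsTrivially : Prop :=
  ∀ (x y : X) (q : CosetFiber K y) (β : Path y y), range β ⊆ U x → q.trans (.mk β) = q

/-- In the chart around `x`, the coordinate of a coset is unchanged when the coset is extended by a
path inside `U x`. -/
theorem ActsTrivially.trans_chartPath_symm (hK : ActsTrivially K U) {x y z : X}
    (hy : JoinedIn (U x) x y) (q : CosetFiber K y) (δ : Path y z) (hδ : range δ ⊆ U x) :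
    q.trans ((Path.Homotopic.Quotient.mk δ).trans (chartPath x₀ U x z).symm) =
      q.trans (chartPath x₀ U x y).symm := by
  have hz : JoinedIn (U x) x z := hy.trans ⟨δ, fun t ↦ hδ (mem_range_self t)⟩
  -- The two extensions of `q` differ by the loop `δ * hz⁻¹ * hy`, which lies in `U x`.
  have hloop := hK x y q ((δ.trans hz.somePath.symm).trans hy.somePath) (by
    rw [Path.trans_range, Path.trans_range, Path.symm_range]
    exact union_subset (union_subset hδ (range_subset_iff.mpr hz.somePath_mem))
      (range_subset_iff.mpr hy.somePath_mem))
  rw [chartPath, chartPath, dif_pos hz, dif_pos hy]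
  conv_rhs => rw [← hloop]
  simp [Path.Homotopic.Quotient.mk_trans, Path.Homotopic.Quotient.mk_symm]

variable (K) in
/-- The chart around `x`: a coset over `y` is moved to the fiber over `x₀` backwards along
`chartPath`. -/
def cosetPretrivialization [LocallyPathConnectedSpace X] {x : X} (hU : IsOpen (U x)) :
    Pretrivialization (CosetFiber K x₀) (π (CosetFiber K x₀) (CosetFiber K)) where
  toFun p := (p.proj, p.snd.trans (chartPath x₀ U x p.proj).symm)
  invFun p := ⟨p.1, p.2.trans (chartPath x₀ U x p.1)⟩
  source := π (CosetFiber K x₀) (CosetFiber K) ⁻¹' pathComponentIn (U x) x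
  target := pathComponentIn (U x) x ×ˢ univ
  map_source' p hp := ⟨hp, mem_univ _⟩
  map_target' p hp := hp.1
  left_inv' p _ := by simp
  right_inv' p _ := by simp
  open_target := (hU.pathComponentIn x).prod isOpen_univ
  baseSet := pathComponentIn (U x) x
  open_baseSet := hU.pathComponentIn x
  source_eq := rfl
  target_eq := rfl
  proj_toFun _ _ := rfl

variable [LocallyPathConnectedSpace X]

/-- The transition between two charts is locally constant on fibers, hence continuous. -/
theorem ActsTrivially.continuousOn_trivChange (hK : ActsTrivially K U) {x x' : X}
    (hU : IsOpen (U x)) (hU' : IsOpen (U x')) :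
    ContinuousOn
      (cosetPretrivialization K hU ∘ (cosetPretrivialization K hU').toPartialEquiv.symm)
      ((cosetPretrivialization K hU').target ∩
        (cosetPretrivialization K hU').toPartialEquiv.symm ⁻¹'
          (cosetPretrivialization K hU).source) := by
  rintro ⟨y, f⟩ ⟨⟨hy', -⟩, hy⟩
  replace hy' : JoinedIn (U x') x' y := hy'
  replace hy : JoinedIn (U x) x y := hy
  refine ContinuousAt.continuousWithinAt ?_
  have hW : IsOpen (U x ∩ U x') := hU.inter hU'
  have hyW : y ∈ U x ∩ U x' := ⟨hy.target_mem, hy'.target_mem⟩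
  have hnhds : pathComponentIn (U x ∩ U x') y ×ˢ {f} ∈ 𝓝 (y, f) :=
    prod_mem_nhds (pathComponentIn_mem_nhds (hW.mem_nhds hyW)) (by simp)
  have hcont : ContinuousAt (fun p : X × CosetFiber K x₀ ↦
      (p.1, (f.trans (chartPath x₀ U x' y)).trans (chartPath x₀ U x y).symm)) (y, f) := by
    fun_prop
  refine hcont.congr ?_
  filter_upwards [hnhds]
  rintro ⟨z, f'⟩ ⟨hz, rfl : f' = f⟩
  replace hz : JoinedIn (U x ∩ U x') y z := hz
  have hδ : range hz.somePath ⊆ U x ∩ U x' := range_subset_iff.mpr hz.somePath_mem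
  have h := hK.trans_chartPath_symm hy (f'.trans (chartPath x₀ U x' y)) hz.somePath
    (hδ.trans inter_subset_left)
  have h' := hK.trans_chartPath_symm hy' (f'.trans (chartPath x₀ U x' y)) hz.somePath
    (hδ.trans inter_subset_right)
  refine Prod.ext rfl ?_
  change _ = (f'.trans (chartPath x₀ U x' z)).trans (chartPath x₀ U x z).symm
  rw [← h]
  replace h' := congrArg (fun q ↦ q.trans (chartPath x₀ U x' z)) h'
  have h'' : (f'.trans (chartPath x₀ U x' y)).trans (.mk hz.somePath) =
      f'.trans (chartPath x₀ U x' z) := by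
    simpa using h'
  rw [← h'', CosetFiber.trans_trans _ (.mk hz.somePath)]

/-- The charts of the covering space of `K` form a prebundle with discrete fibers. -/
def cosetPrebundle (hK : ActsTrivially K U) (hU : ∀ x, IsOpen (U x)) (hxU : ∀ x, x ∈ U x) :
    FiberPrebundle (CosetFiber K x₀) (CosetFiber K) where
  pretrivializationAtlas := range fun x ↦ cosetPretrivialization K (hU x)
  pretrivializationAt x := cosetPretrivialization K (hU x)
  mem_base_pretrivializationAt x := mem_pathComponentIn_self (hxU x)
  pretrivialization_mem_atlas x := mem_range_self x
  continuous_trivChange := by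
    rintro _ ⟨x, rfl⟩ _ ⟨x', rfl⟩
    exact hK.continuousOn_trivChange (hU x) (hU x')
  totalSpaceMk_isInducing y :=
    -- A chart is injective on a fiber, with continuous left inverse given by extension.
    (isInducing_prodMkRight y).comp <|
      .of_comp (g := fun q ↦ q.trans (chartPath x₀ U y y)) continuous_of_discreteTopology
        continuous_of_discreteTopology (by
          have h : (fun q : CosetFiber K x₀ ↦ q.trans (chartPath x₀ U y y)) ∘
              (fun q : CosetFiber K y ↦ q.trans (chartPath x₀ U y y).symm) = id := by
            ext q
            simp
          exact h ▸ Topology.IsInducing.id)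

omit [PathConnectedSpace X] [LocallyPathConnectedSpace X] in
/-- Equality in the covering space for paths whose endpoints agree only propositionally. -/
theorem totalSpaceMk_eq_of_path_eq {y z : X} (a : Path x₀ y) (b : Path x₀ z)
    (hab : ∀ t, a t = b t) :
    (⟨y, .mk K (.mk a)⟩ : TotalSpace (CosetFiber K x₀) (CosetFiber K)) = ⟨z, .mk K (.mk b)⟩ := by
  obtain rfl : y = z := by simpa using hab 1
  obtain rfl : a = b := by ext t; exact hab t
  rfl

variable (K) in
/-- The coset of the part of a path up to time `t`. -/
def cosetInitial {y : X} (γ : Path x₀ y) (t : I) : CosetFiber K (γ t) :=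
  .mk K (.mk ((γ.subpath 0 t).cast γ.source.symm rfl))

omit [PathConnectedSpace X] [LocallyPathConnectedSpace X] in
theorem cosetInitial_trans_subpath {y : X} (γ : Path x₀ y) (t s : I) :
    (cosetInitial K γ t).trans (.mk (γ.subpath t s)) = cosetInitial K γ s :=
  congrArg (CosetFiber.mk K) <| Path.Homotopic.Quotient.eq.mpr <|
    Path.Homotopic.pathCast ⟨Path.Homotopy.subpathTransSubpath γ 0 t s⟩ γ.source.symm rfl

variable (K) in
/-- The lift of a path from `x₀`: at time `t` it is the coset of the part of the path up to `t`. -/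
def cosetLift {y : X} (γ : Path x₀ y) (t : I) : TotalSpace (CosetFiber K x₀) (CosetFiber K) :=
  ⟨γ t, cosetInitial K γ t⟩

omit [PathConnectedSpace X] [LocallyPathConnectedSpace X] in
theorem cosetLift_zero {y : X} (γ : Path x₀ y) :
    cosetLift K γ 0 = ⟨x₀, .mk K (.refl x₀)⟩ :=
  totalSpaceMk_eq_of_path_eq _ (Path.refl x₀) fun t ↦ by simp

omit [PathConnectedSpace X] [LocallyPathConnectedSpace X] in
theorem cosetLift_one {y : X} (γ : Path x₀ y) :
    cosetLift K γ 1 = ⟨y, .mk K (.mk γ)⟩ :=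
  totalSpaceMk_eq_of_path_eq _ γ fun t ↦ by simp

omit [PathConnectedSpace X] [LocallyPathConnectedSpace X] in
theorem eventually_range_subpath_subset {x y : X} (γ : Path x y) (t : I) {V : Set X}
    (hV : V ∈ 𝓝 (γ t)) : ∀ᶠ s in 𝓝 t, range (γ.subpath t s) ⊆ V := by
  have h : ∀ r ∈ (univ : Set I), ∀ᶠ z : I × I in 𝓝 (t, r), γ.subpath t z.1 z.2 ∈ V := by
    intro r _
    have hc : Continuous fun z : I × I ↦ γ.subpath t z.1 z.2 :=
      γ.subpath_continuous_family.comp (continuous_const.prodMk continuous_id)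
    refine hc.continuousAt.eventually_mem ?_
    simpa using hV
  filter_upwards [isCompact_univ.eventually_forall_of_forall_eventually
    (P := fun s r ↦ γ.subpath t s r ∈ V) h] with s hs
  exact range_subset_iff.mpr fun r ↦ hs r (mem_univ r)

theorem continuous_cosetLift (hK : ActsTrivially K U) (hU : ∀ x, IsOpen (U x))
    (hxU : ∀ x, x ∈ U x) {y : X} (γ : Path x₀ y) :
    @Continuous _ _ _ (cosetPrebundle hK hU hxU).totalSpaceTopology (cosetLift K γ) := by
  let _ := (cosetPrebundle hK hU hxU).totalSpaceTopology
  refine continuous_iff_continuousAt.mpr fun t ↦ ?_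
  let e := (cosetPrebundle hK hU hxU).trivializationOfMemPretrivializationAtlas
    (mem_range_self (γ t))
  refine e.continuousAt_of_comp_left γ.continuous.continuousAt
    (mem_pathComponentIn_self (hxU (γ t))) ?_
  have hcont : ContinuousAt (fun s ↦ (γ s, (cosetInitial K γ t).trans
      (chartPath x₀ U (γ t) (γ t)).symm)) t := by
    fun_prop
  refine hcont.congr ?_
  filter_upwards [eventually_range_subpath_subset γ t ((hU (γ t)).mem_nhds (hxU (γ t)))] with s hs
  refine Prod.ext rfl ?_
  change (cosetInitial K γ t).trans (chartPath x₀ U (γ t) (γ t)).symm =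
    (cosetInitial K γ s).trans (chartPath x₀ U (γ t) (γ s)).symm
  rw [← cosetInitial_trans_subpath γ t s, CosetFiber.trans_trans]
  exact (hK.trans_chartPath_symm (JoinedIn.refl (hxU (γ t))) _ _ hs).symm

/-- The covering space is the total space of `cosetPrebundle`, based at the coset of the constant
path. -/
theorem exists_isCoveringMap_of_actsTrivially (hK : ActsTrivially K U) (hU : ∀ x, IsOpen (U x))
    (hxU : ∀ x, x ∈ U x) :
    ∃ (E : Type u) (_ : TopologicalSpace E) (_ : PathConnectedSpace E) (p : C(E, X)) (e₀ : E)
      (he₀ : p e₀ = x₀), IsCoveringMap p ∧ (FundamentalGroup.mapOfEq p he₀).range = K := by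
  let a := cosetPrebundle hK hU hxU
  let _ := a.totalSpaceTopology
  let _ := a.toFiberBundle
  have hcov : IsCoveringMap (π (CosetFiber K x₀) (CosetFiber K)) := FiberBundle.isCoveringMap
  let e₀ : TotalSpace (CosetFiber K x₀) (CosetFiber K) := ⟨x₀, .mk K (.refl x₀)⟩
  have hlift {y : X} (γ : Path x₀ y) : Continuous (cosetLift K γ) :=
    continuous_cosetLift hK hU hxU γ
  have hjoin (e) : Joined e₀ e := by
    obtain ⟨y, q⟩ := e
    obtain ⟨c, rfl⟩ := CosetFiber.mk_surjective q
    obtain ⟨γ, rfl⟩ := Path.Homotopic.Quotient.mk_surjective c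
    exact ⟨⟨⟨cosetLift K γ, hlift γ⟩, cosetLift_zero γ, cosetLift_one γ⟩⟩
  refine ⟨_, inferInstance, ⟨⟨e₀⟩, fun e e' ↦ (hjoin e).symm.trans (hjoin e')⟩,
    ⟨π _ _, hcov.continuous⟩, e₀, rfl, hcov, le_antisymm ?_ ?_⟩
  · rintro _ ⟨g, rfl⟩
    obtain ⟨Γ, rfl⟩ := Path.Homotopic.Quotient.mk_surjective g
    -- By uniqueness of lifts, the loop `Γ` is the lift of its projection `γ`.
    let γ : Path x₀ x₀ := Γ.map hcov.continuous
    have hΓ : ⇑Γ = cosetLift K γ :=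
      hcov.eq_of_comp_eq Γ.continuous (hlift γ) rfl 0 (by rw [Γ.source, cosetLift_zero])
    have hγ : (⟨x₀, .mk K (.mk γ)⟩ : TotalSpace (CosetFiber K x₀) (CosetFiber K)) = e₀ := by
      rw [← cosetLift_one, ← hΓ, Γ.target]
    have hmk : CosetFiber.mk K (.mk γ) = CosetFiber.mk K (.refl x₀) := by
      simpa [e₀] using hγ
    rw [FundamentalGroup.mapOfEq_apply]
    exact CosetFiber.mk_eq_mk_refl.mp hmk
  · intro g hg
    obtain ⟨γ, rfl⟩ := Path.Homotopic.Quotient.mk_surjective g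
    have hend : cosetLift K γ 1 = e₀ := by
      rw [cosetLift_one]
      exact congrArg (TotalSpace.mk x₀) (CosetFiber.mk_eq_mk_refl.mpr hg)
    let Γ : Path e₀ e₀ := ⟨⟨cosetLift K γ, hlift γ⟩, cosetLift_zero γ, hend⟩
    refine ⟨.mk Γ, ?_⟩
    rw [FundamentalGroup.mapOfEq_apply]
    rfl

/-- A subgroup that contains the Spanier group of an open cover is the image of the fundamental
group of a path connected covering space. -/
theorem exists_isCoveringMap_of_spanierGroup_le {𝒰 : Set (Set X)} (h𝒰 : IsOpenCover 𝒰)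
    (hK : spanierGroup 𝒰 x₀ ≤ K) :
    ∃ (E : Type u) (_ : TopologicalSpace E) (_ : PathConnectedSpace E) (p : C(E, X)) (e₀ : E)
      (he₀ : p e₀ = x₀), IsCoveringMap p ∧ (FundamentalGroup.mapOfEq p he₀).range = K := by
  choose U hU hxU using fun x ↦ (h𝒰.2 ▸ mem_univ x : x ∈ ⋃₀ 𝒰)
  exact exists_isCoveringMap_of_actsTrivially (U := U)
    (fun x _ q β hβ ↦ q.trans_loop hK (hU x) β hβ) (fun x ↦ h𝒰.1 _ (hU x)) hxU

end Covering

end StrongSLT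

end

theorem proposition2p1 {X : Type u} [TopologicalSpace X] [ConnectedSpace X]
    [LocallyPathConnectedSpace X] (x₀ : X) (H K : Subgroup (FundamentalGroup X x₀))
    (hX : StrongSLT.IsStrongSLTAt x₀ H) (hHK : H ≤ K)
    (hK : IsOpen[StrongSLT.qtop X x₀] (K : Set (FundamentalGroup X x₀))) :
    (∃ 𝒰 : Set (Set X), StrongSLT.IsOpenCover 𝒰 ∧ StrongSLT.spanierGroup 𝒰 x₀ ≤ K) ∧
    (∃ (E : Type u) (_ : TopologicalSpace E) (_ : PathConnectedSpace E) (p : C(E, X)) (e₀ : E)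
      (he₀ : p e₀ = x₀), IsCoveringMap p ∧ (FundamentalGroup.mapOfEq p he₀).range = K) := by
  obtain ⟨𝒰, h𝒰, hle⟩ := StrongSLT.exists_isOpenCover_spanierGroup_le hX hHK hK
  have : PathConnectedSpace X := .of_locallyPathConnectedSpace
  exact ⟨⟨𝒰, h𝒰, hle⟩, StrongSLT.exists_isCoveringMap_of_spanierGroup_le h𝒰 hle⟩
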